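/- Let $0<m<M$, let $\mathcal H,\mathcal K$ be complex Hilbert spaces, and let $f:[m,M]\to(0,\infty)$ be log-convex, i.e. $\log f$ is convex on $[m,M]$. Let $A\in\mathcal B(\mathcal H)$ satisfy $mI\le A\le MI$, and let $\varphi:\mathcal B(\mathcal H)\to\mathcal B(\mathcal K)$ be a positive linear map with $\varphi(I)=I$. Let $t_0\in(m,M)$ and $t_1>0$. Put $$h(t)=\left(f(M)^{t-m}f(m)^{M-t}\right)^{\frac1{M-m}},\qquad \hat h(t)=f(M)^{t-m}f(m)^{M-t},\qquad h_1(t)=t^{\frac1{M-m}} .$$ For real $p\neq q$ and a function $g$ with $g'(t)\ne 0$, put $$a=\frac{g(q)-g(p)}{q-p},\quad b=\frac{q\,g(p)-p\,g(q)}{q-p},\quad \alpha_{p,q}(g,t)=\frac{a}{g'(t)},\quad \beta_{p,q}(g,t)=a\,t+b-\frac{a\,g(t)}{g'(t)} .$$ All functions of operators are understood by the continuous functional calculus. (i) If $f$ is continuous on the spectrum of $\varphi(A)$ (so that $f(\varphi(A))$ is defined), then $f(\varphi(A))\le h(\varphi(A))$. (ii) Suppose $f(m)\neq f(M)$ (equivalently,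 $h'(t_0)\ne0$), and let $\alpha=\alpha_{m,M}(h,t_0)$, $\beta=\beta_{m,M}(h,t_0)$, and, with $p=f(m)^{M-m}$ and $q=f(M)^{M-m}$, $\alpha_1=\alpha_{p,q}(h_1,t_1)$, $\beta_1=\beta_{p,q}(h_1,t_1)$. Then $$h(\varphi(A))\le\alpha\,\varphi(h(A))+\beta I\le \begin{cases}\alpha\left(\varphi(\hat h(A))\right)^{\frac1{M-m}}+\beta I, & M-m\ge1,\\[2mm] \alpha\,\alpha_1\left(\varphi(\hat h(A))\right)^{\frac1{M-m}}+(\alpha\beta_1+\beta) I, & M-m<1.\end{cases}$$ -/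

import Mathlib

/-- `f` is a positive log-convex function on `s`. -/
def LogConvexOn (s : Set ℝ) (f : ℝ → ℝ) : Prop :=
  (∀ t ∈ s, 0 < f t) ∧ ConvexOn ℝ s (fun t => Real.log (f t))

/-- The slope `a[p, q, g]` of the chord of `g` through `p` and `q`. -/
noncomputable def chordSlope (p q : ℝ) (g : ℝ → ℝ) : ℝ :=
  (g q - g p) / (q - p)

/-- The intercept `b[p, q, g]` of the chord of `g` through `p` and `q`. -/
noncomputable def chordIntercept (p q : ℝ) (g : ℝ → ℝ) : ℝ :=
  (q * g p - p * g q) / (q - p)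

/-- The constant `α(g, t₀) = a_g / g'(t₀)` for `g` between `p` and `q`. -/
noncomputable def mpAlpha (p q : ℝ) (g : ℝ → ℝ) (t₀ : ℝ) : ℝ :=
  chordSlope p q g / deriv g t₀

/-- The constant `β(g, t₀) = a_g t₀ + b_g - a_g g(t₀) / g'(t₀)` for `g` between `p` and `q`. -/
noncomputable def mpBeta (p q : ℝ) (g : ℝ → ℝ) (t₀ : ℝ) : ℝ :=
  chordSlope p q g * t₀ + chordIntercept p q g - chordSlope p q g * g t₀ / deriv g t₀

/-- The function `t ↦ f(M)^(t - m) f(m)^(M - t)`. -/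
noncomputable def endpointProd (m M : ℝ) (f : ℝ → ℝ) (t : ℝ) : ℝ :=
  f M ^ (t - m) * f m ^ (M - t)

/-- The function `h(t) = (f(M)^(t - m) f(m)^(M - t))^(1 / (M - m))`. -/
noncomputable def endpointGeom (m M : ℝ) (f : ℝ → ℝ) (t : ℝ) : ℝ :=
  (f M ^ (t - m) * f m ^ (M - t)) ^ (1 / (M - m))

/-- The function `h₁(t) = t^(1 / (M - m))`. -/
noncomputable def rootFun (m M : ℝ) (t : ℝ) : ℝ :=
  t ^ (1 / (M - m))

/-!
The function `h` is the exponential of the chord of `log f` through the endpoints of `[m, M]`.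
Hence `f ≤ h` on `[m, M]`, which contains the spectrum of `φ(A)`, and the first claim is the
monotonicity of the functional calculus in the function. Moreover `h` is convex.

The first bound of the second part and its case `M - m < 1` compare a convex function `g` with its
chord from above and with a tangent from below. The constants `α` and `β` are chosen so that the
tangent of `α g + β` at `t₀` is the chord of `g`, so `g ≤ chord ≤ α g + β`. The chord is affine,
hence commutes with a unital positive map, and one may apply one of these scalar inequalities on
each side of `φ`. This gives both `g(φ(x)) ≤ α φ(g(x)) + β`
(`ConvexOn.cfc_map_le_mpAlpha_smul_map_cfc`, used for `g = h`) and `φ(g(x)) ≤ α g(φ(x)) + β`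
(`ConvexOn.map_cfc_le_mpAlpha_smul_cfc_map`, used for the convex power `g = h₁` when `M - m < 1`).

For `M - m ≥ 1` the function `h₁` is a power with exponent in `(0, 1]`, and the claim is Jensen's
operator inequality `φ(x ^ p) ≤ φ(x) ^ p` (`PositiveLinearMap.map_cfc_rpow_le`). The power is an
integral of functions that are affine and decreasing in `(t + x)⁻¹`, so it suffices to show
`φ(x)⁻¹ ≤ φ(x⁻¹)` (`PositiveLinearMap.ringInverse_map_le`). Bernstein polynomials supply a partition
of unity `g k` with nodes `c k` satisfying `∑ c k g k(x) = x` exactly and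
`∑ (c k)⁻¹ g k(x) ≤ x⁻¹ + ε`. This reduces the inequality to finitely many positive elements
`C k = φ(g k(x))` of sum one, where it is a completion of the square (`ringInverse_sum_smul_le`).
-/

open Filter Topology MeasureTheory Set Real

/-! ### Bernstein partitions of unity -/

/-- Bernstein interpolation on `[a, b]`: a continuous partition of unity `g k` with nodes `x k`
that reproduces the identity function exactly and `f` up to `ε`. Exactness at the identity is what
makes the noncommutative Jensen argument work without error terms on one side. -/
lemma exists_partition_interpolating {a b : ℝ} (hab : a < b) {f : ℝ → ℝ}
    (hf : ContinuousOn f (Icc a b)) {ε : ℝ} (hε : 0 < ε) :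
    ∃ (n : ℕ) (x : Fin n → ℝ) (g : Fin n → ℝ → ℝ),
      (∀ k, x k ∈ Icc a b) ∧ (∀ k, Continuous (g k)) ∧ (∀ k, ∀ s ∈ Icc a b, 0 ≤ g k s) ∧
      (∀ s ∈ Icc a b, ∑ k, g k s = 1) ∧ (∀ s ∈ Icc a b, ∑ k, x k * g k s = s) ∧
      ∀ s ∈ Icc a b, ∑ k, f (x k) * g k s ≤ f s + ε := by
  have hba : 0 < b - a := sub_pos.2 hab
  -- The affine bijection from `[0, 1]` to `[a, b]`; `u` below is its inverse.
  let node : ℝ → ℝ := fun u => a + u * (b - a)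
  have hnode : ∀ u ∈ unitInterval, node u ∈ Icc a b := fun u hu =>
    ⟨by simp only [node]; nlinarith [hu.1], by simp only [node]; nlinarith [hu.2]⟩
  have hFc : Continuous fun u : unitInterval => f (node u) :=
    hf.comp_continuous (by fun_prop) fun u => hnode u u.2
  let F : C(unitInterval, ℝ) := ⟨fun u => f (node u), hFc⟩
  obtain ⟨n, hn, hn0⟩ := (((Metric.tendsto_nhds.1 (bernsteinApproximation_uniform F)) ε hε).and
    (eventually_ne_atTop 0)).exists
  have hn0' : (n : ℝ) ≠ 0 := by exact_mod_cast hn0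
  let u : ℝ → ℝ := fun s => (s - a) / (b - a)
  have hu : ∀ s ∈ Icc a b, u s ∈ unitInterval := fun s hs =>
    ⟨div_nonneg (by linarith [hs.1]) hba.le, (div_le_one hba).2 (by linarith [hs.2])⟩
  have hb : ∀ (k : Fin (n + 1)) s (hs : s ∈ Icc a b),
      (bernsteinPolynomial ℝ n k).eval (u s) = bernstein n k ⟨u s, hu s hs⟩ := fun k s hs => rfl
  have hsum : ∀ s ∈ Icc a b,
      ∑ k : Fin (n + 1), (bernsteinPolynomial ℝ n k).eval (u s) = 1 := fun s hs => by
    simp only [hb _ s hs, bernstein.probability]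
  refine ⟨n + 1, fun k => node (bernstein.z k),
    fun k s => (bernsteinPolynomial ℝ n k).eval (u s), fun k => hnode _ (bernstein.z k).2,
    fun k => ?_, fun k s hs => ?_, hsum, fun s hs => ?_, fun s hs => ?_⟩
  · exact (Polynomial.continuous _).comp (by fun_prop)
  · simp only [hb k s hs, bernstein_nonneg]
  · have h1 : ∑ k : Fin (n + 1), (k : ℝ) * (bernsteinPolynomial ℝ n k).eval (u s) = n * u s := by
      have := congrArg (Polynomial.eval (u s)) (bernsteinPolynomial.sum_smul ℝ n)
      simpa [Finset.sum_range, Polynomial.eval_finsetSum] using this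
    have h2 : ∀ k : Fin (n + 1), node (bernstein.z k) * (bernsteinPolynomial ℝ n k).eval (u s) =
        a * (bernsteinPolynomial ℝ n k).eval (u s) +
          (b - a) / n * ((k : ℝ) * (bernsteinPolynomial ℝ n k).eval (u s)) := fun k => by
      simp only [node, bernstein.z]; ring
    simp only [h2, Finset.sum_add_distrib, ← Finset.mul_sum, hsum s hs, h1]
    simp only [u]; field_simp; ring
  · have h1 := (ContinuousMap.dist_lt_iff hε).1 hn ⟨u s, hu s hs⟩
    rw [bernsteinApproximation.apply, Real.dist_eq] at h1
    have h2 : F ⟨u s, hu s hs⟩ = f s := by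
      change f (a + (s - a) / (b - a) * (b - a)) = f s
      congr 1; field_simp; ring
    rw [h2] at h1
    have h3 : ∑ k : Fin (n + 1), f (node (bernstein.z k)) * (bernsteinPolynomial ℝ n k).eval (u s)
        = ∑ k : Fin (n + 1), bernstein n k ⟨u s, hu s hs⟩ • F (bernstein.z k) :=
      Finset.sum_congr rfl fun k _ => by rw [hb k s hs, smul_eq_mul, mul_comm]; rfl
    rw [h3]
    linarith [(abs_lt.1 h1).2]

/-! ### Jensen's inequality for the inverse and for powers -/

section CStarAlgebra

variable {A B : Type*} [CStarAlgebra A] [PartialOrder A] [StarOrderedRing A]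
  [CStarAlgebra B] [PartialOrder B] [StarOrderedRing B]

lemma le_of_forall_pos_le_add_smul_one {x y : A}
    (h : ∀ ε : ℝ, 0 < ε → x ≤ y + ε • (1 : A)) : x ≤ y := by
  have : Tendsto (fun ε : ℝ => y + ε • (1 : A)) (𝓝[>] 0) (𝓝 y) :=
    tendsto_nhdsWithin_of_tendsto_nhds (Continuous.tendsto' (by fun_prop) _ _ (by simp))
  exact ge_of_tendsto this (eventually_nhdsWithin_of_forall h)

/-- The inverse of a weighted mean `∑ λₖ Cₖ` is at most the weighted mean of the inverses, for
positive operator weights `Cₖ` of sum one: expand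
`0 ≤ ∑ λₖ⁻¹ (λₖ T⁻¹ - 1) Cₖ (λₖ T⁻¹ - 1)` with `T = ∑ λₖ Cₖ`. -/
lemma ringInverse_sum_smul_le {ι : Type*} [Fintype ι] {c : ι → ℝ} (hc : ∀ k, 0 < c k)
    {C : ι → A} (hC : ∀ k, 0 ≤ C k) (hsum : ∑ k, C k = 1)
    (hT : IsUnit (∑ k, c k • C k)) :
    Ring.inverse (∑ k, c k • C k) ≤ ∑ k, (c k)⁻¹ • C k := by
  set T := ∑ k, c k • C k
  set W := Ring.inverse T
  have hT0 : 0 ≤ T := Finset.sum_nonneg fun k _ => smul_nonneg (hc k).le (hC k)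
  have hW : IsSelfAdjoint W := (IsSelfAdjoint.of_nonneg hT0).ringInverse
  have hWT : W * T = 1 := Ring.inverse_mul_cancel _ hT
  have hterm : ∀ k, 0 ≤ (c k)⁻¹ • ((c k • W - 1) * C k * (c k • W - 1)) := fun k =>
    smul_nonneg (inv_nonneg.2 (hc k).le) <|
      IsSelfAdjoint.conjugate_nonneg (hC k) (((IsSelfAdjoint.all (c k)).smul hW).sub (.one A))
  have hexp : ∀ k, (c k)⁻¹ • ((c k • W - 1) * C k * (c k • W - 1)) =
      W * (c k • C k) * W - W * C k - C k * W + (c k)⁻¹ • C k := fun k => by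
    have := (hc k).ne'
    simp only [sub_mul, mul_sub, one_mul, mul_one, smul_mul_assoc, mul_smul_comm, smul_sub,
      smul_smul]
    rw [show (c k)⁻¹ * (c k * c k) = c k by field_simp, inv_mul_cancel₀ this, one_smul, one_smul]
    abel
  have h := Finset.sum_nonneg fun k (_ : k ∈ Finset.univ) => hterm k
  simp only [hexp, Finset.sum_add_distrib, Finset.sum_sub_distrib, ← Finset.mul_sum,
    ← Finset.sum_mul, hsum, mul_one, one_mul] at h
  change 0 ≤ W * T * W - W - W + _ at h
  rw [hWT, one_mul, sub_self, zero_sub, neg_add_eq_sub] at h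
  exact sub_nonneg.1 h

/-- The spectrum of a strictly positive element lies in an interval `[a, b]` with `0 < a < b`. -/
lemma IsStrictlyPositive.exists_spectrum_subset_Icc {x : A} (hx : IsStrictlyPositive x) :
    ∃ a b : ℝ, 0 < a ∧ a < b ∧ spectrum ℝ x ⊆ Icc a b := by
  have hK : IsCompact (spectrum ℝ x) := spectrum.isCompact (𝕜 := ℝ) x
  obtain ⟨b, hb⟩ := hK.bddAbove
  rcases (spectrum ℝ x).eq_empty_or_nonempty with he | hne
  · exact ⟨1, 2, one_pos, one_lt_two, by simp [he]⟩
  · obtain ⟨a, ha, hmin⟩ := hK.exists_isLeast hne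
    have ha0 : 0 < a := hx.spectrum_pos ha
    exact ⟨a, b + 1, ha0, by linarith [hb ha], fun s hs => ⟨hmin hs, by linarith [hb hs]⟩⟩

lemma PositiveLinearMap.isStrictlyPositive_map (φ : A →ₚ[ℂ] B) (hφ : φ 1 = 1) {x : A}
    (hx : IsStrictlyPositive x) : IsStrictlyPositive (φ x) := by
  obtain ⟨a, b, ha, -, hs⟩ := hx.exists_spectrum_subset_Icc
  have h1 : algebraMap ℝ A a ≤ x :=
    (algebraMap_le_iff_le_spectrum hx.isSelfAdjoint).2 fun s h => (hs h).1
  have h2 : algebraMap ℝ B a ≤ φ x := by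
    have := OrderHomClass.mono φ h1
    rwa [Algebra.algebraMap_eq_smul_one, φ.map_smul_of_tower, hφ,
      ← Algebra.algebraMap_eq_smul_one] at this
  exact IsStrictlyPositive.of_le (isStrictlyPositive_algebraMap ha) h2

/-- **Choi's inequality** for the inverse: `φ(x)⁻¹ ≤ φ(x⁻¹)` for a unital positive map. No complete
positivity is needed, since only functions of `x` enter. -/
theorem PositiveLinearMap.ringInverse_map_le (φ : A →ₚ[ℂ] B) (hφ : φ 1 = 1) {x : A}
    (hx : IsStrictlyPositive x) : Ring.inverse (φ x) ≤ φ (Ring.inverse x) := by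
  have hxs : IsSelfAdjoint x := hx.isSelfAdjoint
  obtain ⟨a, b, ha, hab, hs⟩ := hx.exists_spectrum_subset_Icc
  have hinv : ContinuousOn (fun s : ℝ => s⁻¹) (Icc a b) :=
    continuousOn_inv₀.mono fun s hs => (ha.trans_le hs.1).ne'
  have hxinv : Ring.inverse x = cfc (fun s : ℝ => s⁻¹) x := by
    rw [cfc_inv (fun s : ℝ => s) x fun s h => (ha.trans_le (hs h).1).ne', cfc_id' ℝ x]
  refine le_of_forall_pos_le_add_smul_one fun ε hε => ?_
  obtain ⟨n, c, g, hc, hg, hg0, hg1, hgid, hginv⟩ := exists_partition_interpolating hab hinv hε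
  have hlin : ∀ w : Fin n → ℝ,
      ∑ k, w k • φ (cfc (g k) x) = φ (cfc (fun s => ∑ k, w k * g k s) x) := fun w => by
    have h1 : cfc (fun s => ∑ k, w k * g k s) x = ∑ k, w k • cfc (g k) x := by
      rw [← Finset.sum_fn, cfc_sum_univ (fun k s => w k * g k s) x]
      exact Finset.sum_congr rfl fun k _ => cfc_const_mul (w k) (g k) x
    rw [h1, map_sum]
    exact Finset.sum_congr rfl fun k _ => (φ.map_smul_of_tower _ _).symm
  have hT : ∑ k, c k • φ (cfc (g k) x) = φ x := by
    rw [hlin, cfc_congr fun s h => hgid s (hs h), cfc_id' ℝ x]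
  have hone : ∑ k, φ (cfc (g k) x) = 1 := by
    have := hlin fun _ => 1
    simp only [one_smul, one_mul] at this
    rw [this, cfc_congr fun s h => hg1 s (hs h), cfc_const_one ℝ x, hφ]
  have hchoi := ringInverse_sum_smul_le (fun k => ha.trans_le (hc k).1)
    (fun k => φ.map_nonneg (cfc_nonneg fun s h => hg0 k s (hs h))) hone
    (hT ▸ (φ.isStrictlyPositive_map hφ hx).isUnit)
  rw [hT, hlin] at hchoi
  refine hchoi.trans ?_
  have hle : cfc (fun s => ∑ k, (c k)⁻¹ * g k s) x ≤ Ring.inverse x + ε • (1 : A) := by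
    rw [hxinv, ← Algebra.algebraMap_eq_smul_one,
      ← cfc_add_const ε (fun s : ℝ => s⁻¹) x (hinv.mono hs)]
    exact cfc_mono (fun s h => hginv s (hs h)) (by fun_prop)
      ((hinv.mono hs).add continuousOn_const)
  have := OrderHomClass.mono φ hle
  rwa [map_add, φ.map_smul_of_tower, hφ] at this

lemma cfc_rpowIntegrand₀₁_eq {p t : ℝ} (hp : p ≠ 1) (ht : 0 < t) {y : A} (hy : 0 ≤ y) :
    cfc (rpowIntegrand₀₁ p t) y =
      t ^ (p - 1) • (1 : A) - t ^ p • Ring.inverse (t • 1 + y) := by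
  have hspec : ∀ r ∈ spectrum ℝ y, t + r ≠ 0 := fun r hr =>
    (add_pos_of_pos_of_nonneg ht (spectrum_nonneg_of_nonneg hy hr)).ne'
  have hys : IsSelfAdjoint y := .of_nonneg hy
  have hadd : ContinuousOn (fun z : ℝ => t + z) (spectrum ℝ y) := by fun_prop
  have hg : ContinuousOn (fun z : ℝ => (t + z)⁻¹) (spectrum ℝ y) := hadd.inv₀ hspec
  rw [rpowIntegrand₀₁_eq_sub hp ht,
    cfc_sub (fun _ : ℝ => t ^ (p - 1)) (fun z : ℝ => t ^ p * (t + z)⁻¹) y continuousOn_const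
      (continuousOn_const.mul hg),
    cfc_const _ y hys, cfc_const_mul _ _ y hg, cfc_inv _ y hspec hadd hys,
    cfc_const_add t (fun z : ℝ => z) y continuousOn_id hys, cfc_id' ℝ y,
    Algebra.algebraMap_eq_smul_one, Algebra.algebraMap_eq_smul_one]

/-- For `t > 0` the integrand of the integral representation of `x ↦ x ^ p` satisfies Jensen's
inequality for unital positive maps, as it is a decreasing affine function of `(t + x)⁻¹`. -/
lemma PositiveLinearMap.map_cfc_rpowIntegrand₀₁_le (φ : A →ₚ[ℂ] B) (hφ : φ 1 = 1) {x : A}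
    (hx : 0 ≤ x) {p t : ℝ} (hp : p ≠ 1) (ht : 0 < t) :
    φ (cfc (rpowIntegrand₀₁ p t) x) ≤ cfc (rpowIntegrand₀₁ p t) (φ x) := by
  have hφx := φ.map_nonneg hx
  have hpos : IsStrictlyPositive (t • (1 : A) + x) :=
    IsStrictlyPositive.of_le (isStrictlyPositive_algebraMap ht (𝕜 := ℝ))
      (by rw [Algebra.algebraMap_eq_smul_one]; exact le_add_of_nonneg_right hx)
  have h := φ.ringInverse_map_le hφ hpos
  rw [map_add, φ.map_smul_of_tower, hφ] at h
  rw [cfc_rpowIntegrand₀₁_eq hp ht hx, cfc_rpowIntegrand₀₁_eq hp ht hφx, map_sub,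
    φ.map_smul_of_tower, φ.map_smul_of_tower, hφ]
  exact sub_le_sub_left (smul_le_smul_of_nonneg_left h (by positivity)) _

/-- An integral representation of `x ↦ x ^ p` on the real line carries over to the functional
calculus, with the same measure in every C⋆-algebra. -/
lemma cfc_rpow_eq_integral {p : ℝ} (hp : p ∈ Ioo 0 1) {μ : Measure ℝ}
    (hμ : ∀ x ∈ Ici 0, IntegrableOn (fun t => rpowIntegrand₀₁ p t x) (Ioi 0) μ ∧
      x ^ p = ∫ t in Ioi 0, rpowIntegrand₀₁ p t x ∂μ) {a : A} (ha : 0 ≤ a) :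
    IntegrableOn (fun t => cfc (rpowIntegrand₀₁ p t) a) (Ioi 0) μ ∧
      cfc (fun x : ℝ => x ^ p) a = ∫ t in Ioi 0, cfc (rpowIntegrand₀₁ p t) a ∂μ := by
  have hnn : ∀ z ∈ spectrum ℝ a, 0 ≤ z := fun z hz => spectrum_nonneg_of_nonneg ha hz
  obtain ⟨R, hR⟩ := (spectrum.isCompact (𝕜 := ℝ) a).bddAbove
  have hf := continuousOn_rpowIntegrand₀₁_uncurry hp (spectrum ℝ a) hnn
  -- The integrand increases in `z`, so its value at `max R 0` dominates it on the spectrum; the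
  -- maximum covers an empty spectrum, where `R` may be negative.
  have hR0 : (0 : ℝ) ≤ max R 0 := le_max_right _ _
  have hbound : ∀ᵐ t ∂μ.restrict (Ioi 0), ∀ z ∈ spectrum ℝ a,
      ‖rpowIntegrand₀₁ p t z‖ ≤ ‖rpowIntegrand₀₁ p t (max R 0)‖ := by
    filter_upwards [ae_restrict_mem measurableSet_Ioi] with t ht z hz
    have ht : 0 < t := ht
    rw [Real.norm_of_nonneg (rpowIntegrand₀₁_nonneg hp.1 ht.le (hnn z hz)),
      Real.norm_of_nonneg (rpowIntegrand₀₁_nonneg hp.1 ht.le hR0)]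
    exact rpowIntegrand₀₁_monotoneOn hp ht.le (hnn z hz) hR0 ((hR hz).trans (le_max_left _ _))
  have hfin : HasFiniteIntegral (fun t => ‖rpowIntegrand₀₁ p t (max R 0)‖) (μ.restrict (Ioi 0)) :=
    (hasFiniteIntegral_norm_iff _).2 (hμ _ hR0).1.2
  refine ⟨integrableOn_cfc measurableSet_Ioi _ _ a hf hbound hfin, ?_⟩
  rw [← cfc_setIntegral measurableSet_Ioi _ _ a hf hbound hfin]
  exact cfc_congr fun z hz => (hμ z (hnn z hz)).2

/-- Jensen's inequality `φ(x ^ p) ≤ φ(x) ^ p` for a unital positive map and `0 < p ≤ 1`. -/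
theorem PositiveLinearMap.map_cfc_rpow_le (φ : A →ₚ[ℂ] B) (hφ : φ 1 = 1) {x : A}
    (hx : 0 ≤ x) {p : ℝ} (hp0 : 0 < p) (hp1 : p ≤ 1) :
    φ (cfc (fun s : ℝ => s ^ p) x) ≤ cfc (fun s : ℝ => s ^ p) (φ x) := by
  have hφx := φ.map_nonneg hx
  rcases hp1.eq_or_lt with rfl | hp1
  · simp only [rpow_one]
    rw [cfc_id' ℝ x, cfc_id' ℝ (φ x)]
  obtain ⟨μ, hμ⟩ := exists_measure_rpow_eq_integral_rpowIntegrand₀₁ (p := p) ⟨hp0, hp1⟩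
  obtain ⟨hi1, he1⟩ := cfc_rpow_eq_integral ⟨hp0, hp1⟩ hμ hx
  obtain ⟨hi2, he2⟩ := cfc_rpow_eq_integral ⟨hp0, hp1⟩ hμ hφx
  let L : A →L[ℂ] B := ⟨φ.toLinearMap, map_continuous φ⟩
  have hL := L.integral_comp_comm hi1
  rw [he1, he2]
  change L _ ≤ _
  rw [← hL]
  refine integral_mono_ae (L.integrable_comp hi1) hi2 ?_
  filter_upwards [ae_restrict_mem measurableSet_Ioi] with t ht
  exact φ.map_cfc_rpowIntegrand₀₁_le hφ hx hp1.ne ht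

end CStarAlgebra

/-! ### Chords and tangents of convex functions -/

lemma chordSlope_comm (p q : ℝ) (g : ℝ → ℝ) : chordSlope p q g = chordSlope q p g := by
  rw [chordSlope, chordSlope, ← neg_sub (g p), ← neg_sub p, neg_div_neg_eq]

lemma chordIntercept_comm (p q : ℝ) (g : ℝ → ℝ) :
    chordIntercept p q g = chordIntercept q p g := by
  rw [chordIntercept, chordIntercept, ← neg_sub (p * g q), ← neg_sub p, neg_div_neg_eq]

/-- A convex function lies below its chord. -/
lemma ConvexOn.le_chord {S : Set ℝ} {g : ℝ → ℝ} (hg : ConvexOn ℝ S g) {p q t : ℝ} (hp : p ∈ S)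
    (hq : q ∈ S) (hpq : p ≠ q) (ht : t ∈ uIcc p q) :
    g t ≤ chordSlope p q g * t + chordIntercept p q g := by
  wlog hlt : p < q generalizing p q
  · rw [chordSlope_comm, chordIntercept_comm]
    exact this hq hp hpq.symm (uIcc_comm p q ▸ ht) (lt_of_le_of_ne (not_lt.1 hlt) hpq.symm)
  rw [uIcc_of_le hlt.le] at ht
  have hd : 0 < q - p := sub_pos.2 hlt
  have h := hg.2 hp hq (div_nonneg (sub_nonneg.2 ht.2) hd.le)
    (div_nonneg (sub_nonneg.2 ht.1) hd.le) (by field_simp; ring)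
  simp only [smul_eq_mul] at h
  have e1 : (q - t) / (q - p) * p + (t - p) / (q - p) * q = t := by field_simp; ring
  have e2 : (q - t) / (q - p) * g p + (t - p) / (q - p) * g q =
      chordSlope p q g * t + chordIntercept p q g := by
    rw [chordSlope, chordIntercept]; field_simp; ring
  rwa [e1, e2] at h

/-- A convex function lies above its tangents. -/
lemma ConvexOn.tangent_le {S : Set ℝ} {g : ℝ → ℝ} (hg : ConvexOn ℝ S g) {t₀ t g' : ℝ}
    (ht₀ : t₀ ∈ S) (ht : t ∈ S) (hd : HasDerivAt g g' t₀) : g t₀ + g' * (t - t₀) ≤ g t := by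
  rcases lt_trichotomy t t₀ with h | rfl | h
  · have := hg.slope_le_of_hasDerivAt ht ht₀ h hd
    rw [slope_def_field, div_le_iff₀ (sub_pos.2 h)] at this
    linarith
  · simp
  · have := hg.le_slope_of_hasDerivAt ht₀ ht h hd
    rw [slope_def_field, le_div_iff₀ (sub_pos.2 h)] at this
    linarith

/-- The constants `α` and `β` are made so that the tangent of `α g + β` at `t₀` is the chord
of `g`; hence the chord lies below `α g + β` if `g` is convex and `α` is nonnegative. -/
lemma ConvexOn.chord_le_mpAlpha_mul_add {S : Set ℝ} {g : ℝ → ℝ} (hg : ConvexOn ℝ S g)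
    {p q t₀ t : ℝ} (ht₀ : t₀ ∈ S) (ht : t ∈ S) (hd : deriv g t₀ ≠ 0)
    (hα : 0 ≤ mpAlpha p q g t₀) :
    chordSlope p q g * t + chordIntercept p q g ≤ mpAlpha p q g t₀ * g t + mpBeta p q g t₀ := by
  have htan := mul_le_mul_of_nonneg_left
    (hg.tangent_le ht₀ ht (differentiableAt_of_deriv_ne_zero hd).hasDerivAt) hα
  have hαd : mpAlpha p q g t₀ * deriv g t₀ = chordSlope p q g := div_mul_cancel₀ _ hd
  have hβ : mpBeta p q g t₀ =
      chordSlope p q g * t₀ + chordIntercept p q g - mpAlpha p q g t₀ * g t₀ := by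
    rw [mpBeta, mpAlpha]; ring
  rw [mul_add, ← mul_assoc, hαd] at htan
  rw [hβ]
  linarith

/-! ### Converses of Jensen's inequality by the Mond–Pečarić method -/

lemma cfc_mul_add_const {A : Type*} [CStarAlgebra A] (a b : ℝ) {x : A}
    (hx : IsSelfAdjoint x) :
    cfc (fun s : ℝ => a * s + b) x = a • x + b • (1 : A) := by
  rw [cfc_add_const b (fun s : ℝ => a * s) x, cfc_const_mul_id a x,
    Algebra.algebraMap_eq_smul_one]

lemma cfc_mul_add_const_comp {A : Type*} [CStarAlgebra A] {g : ℝ → ℝ} (α β : ℝ)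
    {x : A} (hx : IsSelfAdjoint x) (hg : ContinuousOn g (spectrum ℝ x)) :
    cfc (fun s => α * g s + β) x = α • cfc g x + β • (1 : A) := by
  rw [cfc_add_const β (fun s => α * g s) x (continuousOn_const.mul hg), cfc_const_mul α g x hg,
    Algebra.algebraMap_eq_smul_one]

section CStarAlgebra

variable {A B : Type*} [CStarAlgebra A] [PartialOrder A] [StarOrderedRing A]
  [CStarAlgebra B] [PartialOrder B] [StarOrderedRing B]

lemma cfc_le_affine {g : ℝ → ℝ} {a b : ℝ} {x : A} (hx : IsSelfAdjoint x)
    (hg : ContinuousOn g (spectrum ℝ x)) (h : ∀ s ∈ spectrum ℝ x, g s ≤ a * s + b) :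
    cfc g x ≤ a • x + b • (1 : A) := by
  rw [← cfc_mul_add_const a b hx]
  exact cfc_mono h hg (by fun_prop)

lemma affine_le_cfc {g : ℝ → ℝ} {a b : ℝ} {x : A} (hx : IsSelfAdjoint x)
    (hg : ContinuousOn g (spectrum ℝ x)) (h : ∀ s ∈ spectrum ℝ x, a * s + b ≤ g s) :
    a • x + b • (1 : A) ≤ cfc g x := by
  rw [← cfc_mul_add_const a b hx]
  exact cfc_mono h (by fun_prop) hg

lemma PositiveLinearMap.isSelfAdjoint_map (φ : A →ₚ[ℂ] B) {x : A} (hx : IsSelfAdjoint x) :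
    IsSelfAdjoint (φ x) := by
  rw [← CFC.posPart_sub_negPart x hx, map_sub]
  exact (IsSelfAdjoint.of_nonneg (φ.map_nonneg (CFC.posPart_nonneg x))).sub
    (IsSelfAdjoint.of_nonneg (φ.map_nonneg (CFC.negPart_nonneg x)))

lemma PositiveLinearMap.spectrum_map_subset_Icc (φ : A →ₚ[ℂ] B) (hφ : φ 1 = 1) {x : A}
    (hx : IsSelfAdjoint x) {a b : ℝ} (hs : spectrum ℝ x ⊆ Icc a b) :
    spectrum ℝ (φ x) ⊆ Icc a b := by
  have hφx := φ.isSelfAdjoint_map hx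
  have hmap : ∀ c : ℝ, φ (algebraMap ℝ A c) = algebraMap ℝ B c := fun c => by
    rw [Algebra.algebraMap_eq_smul_one, φ.map_smul_of_tower, hφ, Algebra.algebraMap_eq_smul_one]
  have h1 := OrderHomClass.mono φ
    ((algebraMap_le_iff_le_spectrum hx).2 fun s h => (hs h).1 : algebraMap ℝ A a ≤ x)
  have h2 := OrderHomClass.mono φ
    ((le_algebraMap_iff_spectrum_le hx).2 fun s h => (hs h).2 : x ≤ algebraMap ℝ A b)
  rw [hmap] at h1 h2
  exact fun s h => ⟨(algebraMap_le_iff_le_spectrum hφx).1 h1 s h,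
    (le_algebraMap_iff_spectrum_le hφx).1 h2 s h⟩

/-- Mond–Pečarić converse of Jensen's inequality: `φ(g(x)) ≤ α g(φ(x)) + β` for convex `g`, since
`g ≤ chord` on the side of `x` and `chord ≤ α g + β` on the side of `φ(x)`. -/
theorem ConvexOn.map_cfc_le_mpAlpha_smul_cfc_map (φ : A →ₚ[ℂ] B) (hφ : φ 1 = 1) {x : A}
    (hx : IsSelfAdjoint x) {S : Set ℝ} {g : ℝ → ℝ} (hg : ConvexOn ℝ S g) (hgc : Continuous g)
    {p q t₀ : ℝ} (hp : p ∈ S) (hq : q ∈ S) (hpq : p ≠ q) (ht₀ : t₀ ∈ S)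
    (hd : deriv g t₀ ≠ 0) (hα : 0 ≤ mpAlpha p q g t₀) (hs : spectrum ℝ x ⊆ uIcc p q) :
    φ (cfc g x) ≤ mpAlpha p q g t₀ • cfc g (φ x) + mpBeta p q g t₀ • (1 : B) := by
  have hφx := φ.isSelfAdjoint_map hx
  have hφs : spectrum ℝ (φ x) ⊆ uIcc p q := φ.spectrum_map_subset_Icc hφ hx hs
  have hS : uIcc p q ⊆ S := hg.1.ordConnected.uIcc_subset hp hq
  have h1 := OrderHomClass.mono φ (cfc_le_affine hx hgc.continuousOn
    fun s h => hg.le_chord hp hq hpq (hs h))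
  rw [map_add, φ.map_smul_of_tower, φ.map_smul_of_tower, hφ] at h1
  refine h1.trans ?_
  rw [← cfc_mul_add_const_comp _ _ hφx hgc.continuousOn]
  exact affine_le_cfc hφx (by fun_prop)
    fun s h => hg.chord_le_mpAlpha_mul_add ht₀ (hS (hφs h)) hd hα

/-- The companion of `ConvexOn.map_cfc_le_mpAlpha_smul_cfc_map` with the roles of `x` and `φ(x)`
exchanged: `g(φ(x)) ≤ α φ(g(x)) + β`. -/
theorem ConvexOn.cfc_map_le_mpAlpha_smul_map_cfc (φ : A →ₚ[ℂ] B) (hφ : φ 1 = 1) {x : A}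
    (hx : IsSelfAdjoint x) {S : Set ℝ} {g : ℝ → ℝ} (hg : ConvexOn ℝ S g) (hgc : Continuous g)
    {p q t₀ : ℝ} (hp : p ∈ S) (hq : q ∈ S) (hpq : p ≠ q) (ht₀ : t₀ ∈ S)
    (hd : deriv g t₀ ≠ 0) (hα : 0 ≤ mpAlpha p q g t₀) (hs : spectrum ℝ x ⊆ uIcc p q) :
    cfc g (φ x) ≤ mpAlpha p q g t₀ • φ (cfc g x) + mpBeta p q g t₀ • (1 : B) := by
  have hφx := φ.isSelfAdjoint_map hx
  have hφs : spectrum ℝ (φ x) ⊆ uIcc p q := φ.spectrum_map_subset_Icc hφ hx hs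
  have hS : uIcc p q ⊆ S := hg.1.ordConnected.uIcc_subset hp hq
  refine (cfc_le_affine hφx hgc.continuousOn
    fun s h => hg.le_chord hp hq hpq (hφs h)).trans ?_
  have h1 := OrderHomClass.mono φ (affine_le_cfc (g := fun s => mpAlpha p q g t₀ * g s +
    mpBeta p q g t₀) hx (by fun_prop)
    fun s h => hg.chord_le_mpAlpha_mul_add ht₀ (hS (hs h)) hd hα)
  rw [cfc_mul_add_const_comp _ _ hx hgc.continuousOn] at h1
  simpa only [map_add, φ.map_smul_of_tower, hφ] using h1

end CStarAlgebra

/-! ### The exponential interpolant of the endpoint values -/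

section Endpoint

variable {m M : ℝ} {f : ℝ → ℝ}

lemma endpointProd_eq_exp (hm : 0 < f m) (hM : 0 < f M) (t : ℝ) :
    endpointProd m M f t = exp ((t - m) * log (f M) + (M - t) * log (f m)) := by
  rw [endpointProd, rpow_def_of_pos hM, rpow_def_of_pos hm, ← exp_add]
  ring_nf

lemma endpointGeom_eq_rootFun (m M : ℝ) (f : ℝ → ℝ) (t : ℝ) :
    endpointGeom m M f t = rootFun m M (endpointProd m M f t) := rfl

lemma endpointGeom_eq_exp (hm : 0 < f m) (hM : 0 < f M) (t : ℝ) :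
    endpointGeom m M f t =
      exp (((t - m) * log (f M) + (M - t) * log (f m)) / (M - m)) := by
  rw [endpointGeom_eq_rootFun, endpointProd_eq_exp hm hM, rootFun, ← exp_mul, mul_one_div]

lemma endpointGeom_left (hmM : m < M) (hm : 0 < f m) (hM : 0 < f M) :
    endpointGeom m M f m = f m := by
  rw [endpointGeom_eq_exp hm hM, sub_self, zero_mul, zero_add,
    mul_div_cancel_left₀ _ (sub_pos.2 hmM).ne', exp_log hm]

lemma endpointGeom_right (hmM : m < M) (hm : 0 < f m) (hM : 0 < f M) :
    endpointGeom m M f M = f M := by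
  rw [endpointGeom_eq_exp hm hM, sub_self, zero_mul, add_zero,
    mul_div_cancel_left₀ _ (sub_pos.2 hmM).ne', exp_log hM]

/-- The logarithm of `h` is the chord of `log f` through the endpoints. -/
lemma LogConvexOn.le_endpointGeom (hf : LogConvexOn (Icc m M) f) (hmM : m < M) {t : ℝ}
    (ht : t ∈ Icc m M) : f t ≤ endpointGeom m M f t := by
  have hml := left_mem_Icc.2 hmM.le
  have hMr := right_mem_Icc.2 hmM.le
  have h := hf.2.le_chord hml hMr hmM.ne (uIcc_of_le hmM.le ▸ ht)
  rw [endpointGeom_eq_exp (hf.1 m hml) (hf.1 M hMr), ← log_le_iff_le_exp (hf.1 t ht)]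
  refine h.trans_eq ?_
  rw [chordSlope, chordIntercept]
  ring

lemma hasDerivAt_endpointGeom (hm : 0 < f m) (hM : 0 < f M) (t : ℝ) :
    HasDerivAt (endpointGeom m M f)
      (endpointGeom m M f t * ((log (f M) - log (f m)) / (M - m))) t := by
  have h1 : HasDerivAt (fun t => ((t - m) * log (f M) + (M - t) * log (f m)) / (M - m))
      ((1 * log (f M) + -1 * log (f m)) / (M - m)) t :=
    ((((hasDerivAt_id t).sub_const m).mul_const _).add
      (((hasDerivAt_id t).const_sub M).mul_const _)).div_const _
  have h2 := h1.exp
  rw [← endpointGeom_eq_exp hm hM, one_mul, neg_one_mul, ← sub_eq_add_neg] at h2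
  exact h2.congr_of_eventuallyEq (.of_forall fun s => endpointGeom_eq_exp hm hM s)

lemma convexOn_endpointGeom (hm : 0 < f m) (hM : 0 < f M) :
    ConvexOn ℝ univ (endpointGeom m M f) := by
  refine ⟨convex_univ, fun x _ y _ a b ha hb hab => ?_⟩
  simp only [endpointGeom_eq_exp hm hM]
  refine le_trans (le_of_eq ?_) (convexOn_exp.2 (mem_univ _) (mem_univ _) ha hb hab)
  have hb' : b = 1 - a := by linarith
  subst hb'
  simp only [smul_eq_mul]
  congr 1
  ring

lemma continuous_endpointGeom (hm : 0 < f m) (hM : 0 < f M) :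
    Continuous (endpointGeom m M f) :=
  continuous_iff_continuousAt.2 fun t => (hasDerivAt_endpointGeom hm hM t).continuousAt

lemma continuous_endpointProd (hm : 0 < f m) (hM : 0 < f M) :
    Continuous (endpointProd m M f) := by
  rw [funext (endpointProd_eq_exp (m := m) (M := M) hm hM)]
  fun_prop

lemma continuous_rootFun (hmM : m < M) : Continuous (rootFun m M) :=
  Real.continuous_rpow_const (one_div_nonneg.2 (sub_pos.2 hmM).le)

lemma deriv_endpointGeom_ne_zero (hmM : m < M) (hm : 0 < f m) (hM : 0 < f M) (hne : f m ≠ f M)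
    (t : ℝ) : deriv (endpointGeom m M f) t ≠ 0 := by
  rw [(hasDerivAt_endpointGeom hm hM t).deriv, endpointGeom_eq_exp hm hM]
  exact mul_ne_zero (exp_pos _).ne' (div_ne_zero
    (sub_ne_zero.2 fun h => hne (log_injOn_pos hm hM h.symm)) (sub_pos.2 hmM).ne')

/-- The chord slope and the derivative of `h` have the same sign. -/
lemma mpAlpha_endpointGeom_nonneg (hmM : m < M) (hm : 0 < f m) (hM : 0 < f M) (t : ℝ) :
    0 ≤ mpAlpha m M (endpointGeom m M f) t := by
  have hd := sub_pos.2 hmM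
  rw [mpAlpha, (hasDerivAt_endpointGeom hm hM t).deriv, chordSlope, endpointGeom_left hmM hm hM,
    endpointGeom_right hmM hm hM, endpointGeom_eq_exp hm hM]
  rcases le_total (f m) (f M) with h | h
  · exact div_nonneg (div_nonneg (sub_nonneg.2 h) hd.le) (mul_nonneg (exp_pos _).le
      (div_nonneg (sub_nonneg.2 (log_le_log hm h)) hd.le))
  · exact div_nonneg_of_nonpos (div_nonpos_of_nonpos_of_nonneg (sub_nonpos.2 h) hd.le)
      (mul_nonpos_of_nonneg_of_nonpos (exp_pos _).le
      (div_nonpos_of_nonpos_of_nonneg (sub_nonpos.2 (log_le_log hM h)) hd.le))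

lemma endpointProd_mem_uIcc (hm : 0 < f m) (hM : 0 < f M) {t : ℝ} (ht : t ∈ Icc m M) :
    endpointProd m M f t ∈ uIcc (f m ^ (M - m)) (f M ^ (M - m)) := by
  rw [endpointProd_eq_exp hm hM, rpow_def_of_pos hm, rpow_def_of_pos hM, mem_uIcc]
  simp only [exp_le_exp]
  rcases le_total (log (f m)) (log (f M)) with h | h
  · left; constructor <;> nlinarith [ht.1, ht.2]
  · right; constructor <;> nlinarith [ht.1, ht.2]

lemma hasDerivAt_rootFun {t : ℝ} (ht : 0 < t) :
    HasDerivAt (rootFun m M) (1 / (M - m) * t ^ (1 / (M - m) - 1)) t :=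
  Real.hasDerivAt_rpow_const (Or.inl ht.ne')

lemma deriv_rootFun_pos (hmM : m < M) {t : ℝ} (ht : 0 < t) : 0 < deriv (rootFun m M) t := by
  rw [(hasDerivAt_rootFun ht).deriv]
  exact mul_pos (one_div_pos.2 (sub_pos.2 hmM)) (rpow_pos_of_pos ht _)

lemma mpAlpha_rootFun_nonneg (hmM : m < M) {p q t : ℝ} (hp : 0 ≤ p) (hq : 0 ≤ q) (ht : 0 < t) :
    0 ≤ mpAlpha p q (rootFun m M) t := by
  have hr : 0 ≤ 1 / (M - m) := one_div_nonneg.2 (sub_pos.2 hmM).le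
  refine div_nonneg ?_ (deriv_rootFun_pos hmM ht).le
  rcases le_total p q with h | h
  · exact div_nonneg (sub_nonneg.2 (rpow_le_rpow hp h hr)) (sub_nonneg.2 h)
  · exact div_nonneg_of_nonpos (sub_nonpos.2 (rpow_le_rpow hq h hr)) (sub_nonpos.2 h)

lemma convexOn_rootFun (hmM : m < M) (h : M - m ≤ 1) : ConvexOn ℝ (Ici 0) (rootFun m M) :=
  convexOn_rpow ((one_le_div (sub_pos.2 hmM)).2 h)

lemma cfc_endpointGeom_eq_cfc_rootFun {A : Type*} [CStarAlgebra A] (hmM : m < M) (hm : 0 < f m)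
    (hM : 0 < f M) {x : A} (hx : IsSelfAdjoint x) :
    cfc (endpointGeom m M f) x = cfc (rootFun m M) (cfc (endpointProd m M f) x) :=
  cfc_comp (rootFun m M) (endpointProd m M f) x hx (continuous_rootFun hmM).continuousOn
    (continuous_endpointProd hm hM).continuousOn

end Endpoint

/-! ### Inequalities for log-convex functions -/

theorem mainTheorem1
    {H K : Type*}
    [NormedAddCommGroup H] [InnerProductSpace ℂ H] [CompleteSpace H]
    [NormedAddCommGroup K] [InnerProductSpace ℂ K] [CompleteSpace K]
    (m M : ℝ) (hm : 0 < m) (hmM : m < M)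
    (f : ℝ → ℝ) (hf : LogConvexOn (Set.Icc m M) f)
    (A : H →L[ℂ] H) (hmA : m • (1 : H →L[ℂ] H) ≤ A) (hAM : A ≤ M • (1 : H →L[ℂ] H))
    (φ : (H →L[ℂ] H) →ₚ[ℂ] (K →L[ℂ] K)) (hφ : φ 1 = 1)
    (t₀ t₁ : ℝ) (ht₀ : t₀ ∈ Set.Ioo m M) (ht₁ : 0 < t₁)
    (h h₁ : ℝ → ℝ) (hh : h = endpointGeom m M f) (hh₁ : h₁ = rootFun m M)
    (α β α₁ β₁ : ℝ)
    (hα : α = mpAlpha m M h t₀) (hβ : β = mpBeta m M h t₀)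
    (hα₁ : α₁ = mpAlpha (f m ^ (M - m)) (f M ^ (M - m)) h₁ t₁)
    (hβ₁ : β₁ = mpBeta (f m ^ (M - m)) (f M ^ (M - m)) h₁ t₁) :
    -- `f(φ(A))` is formed by the continuous functional calculus
    (ContinuousOn f (spectrum ℝ (φ A)) → cfc f (φ A) ≤ cfc h (φ A)) ∧
    -- `f m ≠ f M` says exactly that `h'(t₀) ≠ 0`, so that `α` and `β` are defined
    (f m ≠ f M →
      cfc h (φ A) ≤ α • φ (cfc h A) + β • (1 : K →L[ℂ] K) ∧
      (1 ≤ M - m →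
        α • φ (cfc h A) + β • (1 : K →L[ℂ] K) ≤
          α • cfc h₁ (φ (cfc (endpointProd m M f) A)) + β • (1 : K →L[ℂ] K)) ∧
      (M - m < 1 →
        α • φ (cfc h A) + β • (1 : K →L[ℂ] K) ≤
          (α * α₁) • cfc h₁ (φ (cfc (endpointProd m M f) A)) +
            (α * β₁ + β) • (1 : K →L[ℂ] K))) := by
  subst hh hh₁ hα hβ hα₁ hβ₁
  have hfm : 0 < f m := hf.1 m (left_mem_Icc.2 hmM.le)
  have hfM : 0 < f M := hf.1 M (right_mem_Icc.2 hmM.le)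
  have hd : 0 < M - m := sub_pos.2 hmM
  have hA : IsSelfAdjoint A := .of_nonneg ((smul_nonneg hm.le zero_le_one).trans hmA)
  have hs : spectrum ℝ A ⊆ Icc m M := fun s h =>
    ⟨(algebraMap_le_iff_le_spectrum hA).1 (by rwa [Algebra.algebraMap_eq_smul_one]) s h,
      (le_algebraMap_iff_spectrum_le hA).1 (by rwa [Algebra.algebraMap_eq_smul_one]) s h⟩
  have hφs := φ.spectrum_map_subset_Icc hφ hA hs
  refine ⟨fun hfc => cfc_mono (fun s h => hf.le_endpointGeom hmM (hφs h)) hfc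
    (continuous_endpointGeom hfm hfM).continuousOn, fun hne => ?_⟩
  have hα := mpAlpha_endpointGeom_nonneg hmM hfm hfM t₀
  have hBA : IsSelfAdjoint (cfc (endpointProd m M f) A) := cfc_predicate _ A
  have hBs : spectrum ℝ (cfc (endpointProd m M f) A) ⊆
      uIcc (f m ^ (M - m)) (f M ^ (M - m)) := by
    rw [cfc_map_spectrum _ A hA (continuous_endpointProd hfm hfM).continuousOn]
    rintro _ ⟨s, h, rfl⟩
    exact endpointProd_mem_uIcc hfm hfM (hs h)
  have hp : 0 < f m ^ (M - m) := rpow_pos_of_pos hfm _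
  have hq : 0 < f M ^ (M - m) := rpow_pos_of_pos hfM _
  have hcomp := cfc_endpointGeom_eq_cfc_rootFun hmM hfm hfM hA
  refine ⟨?_, fun h1 => ?_, fun h1 => ?_⟩
  · exact (convexOn_endpointGeom hfm hfM).cfc_map_le_mpAlpha_smul_map_cfc φ hφ hA
      (continuous_endpointGeom hfm hfM) (mem_univ m) (mem_univ M) hmM.ne (mem_univ t₀)
      (deriv_endpointGeom_ne_zero hmM hfm hfM hne t₀) hα (uIcc_of_le hmM.le ▸ hs)
  -- `h = h₁ ∘ ĥ` with `ĥ = endpointProd m M f`, and here `h₁` is a power with exponent in `(0, 1]`.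
  · have hB0 : 0 ≤ cfc (endpointProd m M f) A := cfc_nonneg fun s _ => by
      rw [endpointProd_eq_exp hfm hfM]
      exact (exp_pos _).le
    have h2 : φ (cfc (rootFun m M) _) ≤ cfc (rootFun m M) _ :=
      φ.map_cfc_rpow_le hφ hB0 (one_div_pos.2 hd) ((div_le_one hd).2 h1)
    rw [hcomp]
    gcongr
  -- Here the exponent of `h₁` exceeds one, so `h₁` is convex; its chord runs over an interval
  -- containing the spectrum of `ĥ(A)`, whose ends come in the order of `f m` and `f M`.
  · have hpq : f m ^ (M - m) ≠ f M ^ (M - m) := fun h =>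
      hne (rpow_left_injOn hd.ne' hfm.le hfM.le h)
    have h2 := (convexOn_rootFun hmM h1.le).map_cfc_le_mpAlpha_smul_cfc_map φ hφ hBA
      (continuous_rootFun hmM) (mem_Ici.2 hp.le) (mem_Ici.2 hq.le) hpq (mem_Ici.2 ht₁.le)
      (deriv_rootFun_pos hmM ht₁).ne' (mpAlpha_rootFun_nonneg hmM hp.le hq.le ht₁) hBs
    rw [hcomp, mul_smul, add_smul, mul_smul, ← add_assoc, ← smul_add]
    gcongr
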